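/- Let $R$ be a commutative ring with unit. For a finite matroid $G$ let $\mathcal E(G)$ be the exterior algebra over $R$ on generators $e_i$ of degree one, one for each point $i$ of $G$, and let $\partial$ be the linear map $\partial(e_{i_1}\wedge\cdots\wedge e_{i_p})=\sum_{k=1}^p(-1)^{k-1}e_{i_1}\wedge\cdots\wedge\widehat{e_{i_k}}\wedge\cdots\wedge e_{i_p}$. The Orlik–Solomon algebra of $G$ is the graded algebra $\mathcal A(G)=\mathcal E(G)/\mathcal I$, where $\mathcal I$ is the ideal generated by the elements $\partial(e_{i_1}\wedge\cdots\wedge e_{i_p})$ for all dependent tuples $(i_1,\dots,i_p)$ of points; $a_i$ denotes the image of $e_i$. A pointed matroid $dG$ is a matroid $G$ with a base point $0$ in its ground set, and its affine Orlik–Solomon algebra $\mathcal A_d(dG)$ is the graded subalgebra of $\mathcal A(G)$ generated by the elements $a_i-a_0$, where $i$ runs over the points of $G$. Let $dG_0$ and $dG_1$ be pointed matroids with finite ground sets whose base points are not loops (for instance, simple matroids), and let $P_d(dG_0,dG_1)$ be their parallel connection, that is, the pointed matroid of largest rank that is a union of pointed submatroids isomorphic to $dG_0$ and $dG_1$ whose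 ground sets intersect only at the base point. Let $f_0$ and $f_1$ be the inclusions of the points of $G_0$ and $G_1$ in those of $P_d(dG_0,dG_1)$. **Theorem 3.8.** There is an isomorphism of graded $R$-algebras $$\Phi:\ \mathcal A_d(dG_0)\otimes\mathcal A_d(dG_1)\ \xrightarrow{\ \cong\ }\ \mathcal A_d\bigl(P_d(dG_0,dG_1)\bigr),$$ where $\otimes$ is the tensor product over $R$ of graded algebras, with multiplication $(x\otimes y)(x'\otimes y')=(-1)^{\deg y\,\deg x'}\,xx'\otimes yy'$ for homogeneous elements, and where $x\otimes y$ has degree $\deg x+\deg y$. It is the natural homomorphism induced by the inclusions: $\Phi\bigl((a_i-a_0)\otimes1\bigr)=a_{f_0(i)}-a_0$ for every point $i$ of $G_0$, and $\Phi\bigl(1\otimes(a_j-a_0)\bigr)=a_{f_1(j)}-a_0$ for every point $j$ of $G_1$. -/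

import Mathlib

open scoped TensorProduct DirectSum

noncomputable section

/-- A pointed matroid: a matroid with a specified base point in its ground set. -/
structure PointedMatroid (α : Type*) where
  /-- the underlying unpointed matroid -/
  matroid : Matroid α
  /-- the base point -/
  base : α
  base_mem : base ∈ matroid.E

namespace PointedMatroid

/-- The type of points (elements of the ground set). -/
abbrev Pt {α : Type*} (G : PointedMatroid α) : Type _ := ↥G.matroid.E

/-- The base point, as an element of the type of points. -/
def basePt {α : Type*} (G : PointedMatroid α) : G.Pt := ⟨G.base, G.base_mem⟩

/-- `f` identifies `G` with a pointed submatroid (restriction to a subset of the ground set that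
contains the base point) of `P`. -/
structure IsEmbedding {α γ : Type*} (G : PointedMatroid α) (P : PointedMatroid γ)
    (f : G.Pt → P.Pt) : Prop where
  injective : Function.Injective f
  map_base : f G.basePt = P.basePt
  indep_iff : ∀ I : Set G.Pt,
    P.matroid.Indep ((fun i : G.Pt => (f i : γ)) '' I) ↔
      G.matroid.Indep ((fun i : G.Pt => (i : α)) '' I)

/-- `P` is a union of two pointed submatroids, isomorphic to `G₀` and `G₁` by means of `f₀` and
`f₁`, whose ground sets intersect only at the base point. -/
structure IsUnion {α β γ : Type*} (G₀ : PointedMatroid α) (G₁ : PointedMatroid β)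
    (P : PointedMatroid γ) (f₀ : G₀.Pt → P.Pt) (f₁ : G₁.Pt → P.Pt) : Prop where
  left : G₀.IsEmbedding P f₀
  right : G₁.IsEmbedding P f₁
  union_eq : Set.range f₀ ∪ Set.range f₁ = Set.univ
  inter_eq : Set.range f₀ ∩ Set.range f₁ = {P.basePt}

/-- `P`, together with the inclusions `f₀` and `f₁`, is the parallel connection of the pointed
matroids `G₀` and `G₁`: it has the largest rank among all pointed matroids that are unions of
copies of `G₀` and `G₁` whose ground sets intersect only at the base point. (All such finite unions
have the same number of points, so each of them has a copy on the ground set of `P`; it is no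
restriction that the competitors `Q` live on the same type as `P`.) -/
structure IsParallelConnection {α β γ : Type*} (G₀ : PointedMatroid α) (G₁ : PointedMatroid β)
    (P : PointedMatroid γ) (f₀ : G₀.Pt → P.Pt) (f₁ : G₁.Pt → P.Pt) : Prop where
  isUnion : G₀.IsUnion G₁ P f₀ f₁
  eRank_le : ∀ (Q : PointedMatroid γ) (g₀ : G₀.Pt → Q.Pt) (g₁ : G₁.Pt → Q.Pt),
    G₀.IsUnion G₁ Q g₀ g₁ → Q.matroid.eRank ≤ P.matroid.eRank

end PointedMatroid

/-! ### The Orlik-Solomon algebra of a matroid -/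

namespace OrlikSolomon

variable (R : Type*) [CommRing R]

/-- The exterior algebra `ℰ` on one generator for each element of `X`. -/
abbrev Ext (X : Type*) : Type _ := ExteriorAlgebra R (X →₀ R)

/-- The generator `e i` of the exterior algebra. -/
def e {X : Type*} (i : X) : Ext R X := ExteriorAlgebra.ι R (Finsupp.single i 1)

/-- The product `e_S = e_{i₁} ∧ ⋯ ∧ e_{iₚ}` for a tuple `S = (i₁, …, iₚ)`. -/
def eProd {X : Type*} (S : List X) : Ext R X := (S.map (e R)).prod

/-- The linear map `∂`: contraction with the linear form that sends every `e i` to `1`. See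
`boundary_eProd` for its values on the products `e_S`. -/
def boundary (X : Type*) : Ext R X →ₗ[R] Ext R X :=
  CliffordAlgebra.contractLeft (Finsupp.linearCombination R (fun _ : X => (1 : R)))

variable {R}

theorem boundary_e_mul {X : Type*} (i : X) (x : Ext R X) :
    boundary R X (e R i * x) = x - e R i * boundary R X x := by
  simp [boundary, e, ExteriorAlgebra.ι, CliffordAlgebra.contractLeft_ι_mul]

/-- `∂(e_{i₁} ∧ ⋯ ∧ e_{iₚ}) = ∑ₖ (-1)ᵏ⁻¹ e_{i₁} ∧ ⋯ ∧ (omit e_{iₖ}) ∧ ⋯ ∧ e_{iₚ}`; here the index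
`k` starts from `0`. -/
theorem boundary_eProd {X : Type*} (S : List X) :
    boundary R X (eProd R S)
      = ∑ k : Fin S.length, (-1 : R) ^ (k : ℕ) • eProd R (S.eraseIdx (k : ℕ)) := by
  induction S with
  | nil => simp [eProd, boundary]
  | cons i S ih =>
    have h : eProd R (i :: S) = e R i * eProd R S := by simp [eProd]
    rw [h, boundary_e_mul, ih]
    simp only [List.length_cons]
    rw [Fin.sum_univ_succ]
    simp only [Fin.val_zero, pow_zero, one_smul, List.eraseIdx_cons_zero, Fin.val_succ,
      List.eraseIdx_cons_succ, Finset.mul_sum, sub_eq_add_neg, ← Finset.sum_neg_distrib]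
    congr 1
    refine Finset.sum_congr rfl fun k _ => ?_
    simp [eProd, pow_succ]

variable (R)

variable {α : Type*} (M : Matroid α)

/-- The tuple `S` of points is dependent. -/
def IsDependent (S : List ↥M.E) : Prop := M.Dep {x | ∃ i ∈ S, (i : α) = x}

/-- The relations `∂ e_S = 0` for `S` dependent. -/
inductive Rel : Ext R ↥M.E → Ext R ↥M.E → Prop
  | of (S : List ↥M.E) (hS : IsDependent M S) : Rel (boundary R ↥M.E (eProd R S)) 0

/-- The Orlik-Solomon algebra `𝒜(M)` with coefficients in `R`: the quotient of the exterior algebra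
on the points of `M` by the (two-sided) ideal generated by all `∂ e_S` with `S` dependent. -/
def OS : Type _ := RingQuot (Rel R M)

instance : Ring (OS R M) := inferInstanceAs (Ring (RingQuot (Rel R M)))

instance : Algebra R (OS R M) := inferInstanceAs (Algebra R (RingQuot (Rel R M)))

/-- The quotient map from the exterior algebra. -/
def mk : Ext R ↥M.E →ₐ[R] OS R M := RingQuot.mkAlgHom R (Rel R M)

/-- The generator `a i` of the Orlik-Solomon algebra. -/
def a (i : ↥M.E) : OS R M := mk R M (e R i)

/-- The component of degree `p` of the Orlik-Solomon algebra: the image of the `p`-th exterior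
power. -/
def grading (p : ℕ) : Submodule R (OS R M) :=
  (⋀[R]^p (↥M.E →₀ R)).map (mk R M).toLinearMap

variable {R M}

theorem mk_boundary {S : List ↥M.E} (hS : IsDependent M S) :
    mk R M (boundary R ↥M.E (eProd R S)) = 0 := by
  have := RingQuot.mkAlgHom_rel R (Rel.of (R := R) S hS)
  rw [map_zero] at this
  exact this

instance : SetLike.GradedMonoid (grading R M) where
  one_mem := ⟨1, SetLike.GradedOne.one_mem, map_one (mk R M)⟩
  mul_mem := by
    rintro i j _ _ ⟨x, hx, rfl⟩ ⟨y, hy, rfl⟩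
    exact ⟨x * y, SetLike.GradedMul.mul_mem hx hy, map_mul (mk R M) _ _⟩

theorem mk_mem_grading {p : ℕ} {x : Ext R ↥M.E} (hx : x ∈ ⋀[R]^p (↥M.E →₀ R)) :
    mk R M x ∈ grading R M p := ⟨x, hx, rfl⟩

theorem ι_mem {X : Type*} (m : X →₀ R) : ExteriorAlgebra.ι R m ∈ ⋀[R]^1 (X →₀ R) := by
  rw [ExteriorAlgebra.exteriorPower, pow_one]; exact ⟨_, rfl⟩

theorem e_mem {X : Type*} (i : X) : e R i ∈ ⋀[R]^1 (X →₀ R) := ι_mem _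

theorem eProd_mem {X : Type*} (S : List X) : eProd R S ∈ ⋀[R]^S.length (X →₀ R) := by
  induction S with
  | nil => exact SetLike.GradedOne.one_mem (A := fun p : ℕ => ⋀[R]^p (X →₀ R))
  | cons i S ih =>
    have h : eProd R (i :: S) = e R i * eProd R S := by simp [eProd]
    rw [h, List.length_cons, add_comm]
    exact SetLike.GradedMul.mul_mem (A := fun p : ℕ => ⋀[R]^p (X →₀ R)) (e_mem i) ih

theorem boundary_eProd_mem {X : Type*} (S : List X) :
    boundary R X (eProd R S) ∈ ⋀[R]^(S.length - 1) (X →₀ R) := by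
  rw [boundary_eProd]
  refine Submodule.sum_mem _ fun k _ => Submodule.smul_mem _ _ ?_
  have h := eProd_mem (R := R) (S.eraseIdx k)
  rwa [List.length_eraseIdx_of_lt k.2] at h

/-- The map that decomposes an element of the exterior algebra into the homogeneous components of
its image in the Orlik-Solomon algebra. -/
def decomposeExt (R : Type*) [CommRing R] (M : Matroid α) :
    Ext R ↥M.E →ₐ[R] ⨁ p, grading R M p :=
  ExteriorAlgebra.lift R
    ⟨DirectSum.lof R ℕ (fun p => grading R M p) 1 ∘ₗ
      ((mk R M).toLinearMap ∘ₗ ExteriorAlgebra.ι R).codRestrict _ fun m =>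
        mk_mem_grading (ι_mem m), fun m => by
      rw [LinearMap.comp_apply, DirectSum.lof_eq_of, DirectSum.of_mul_of]
      refine DFinsupp.single_eq_zero.mpr (Subtype.ext ?_)
      change mk R M (ExteriorAlgebra.ι R m) * mk R M (ExteriorAlgebra.ι R m) = 0
      rw [← map_mul, ExteriorAlgebra.ι_sq_zero, map_zero]⟩

theorem decomposeExt_of_mem {p : ℕ} {x : Ext R ↥M.E} (hx : x ∈ ⋀[R]^p (↥M.E →₀ R)) :
    decomposeExt R M x
      = DirectSum.of (fun p => grading R M p) p ⟨mk R M x, mk_mem_grading hx⟩ := by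
  induction hx using Submodule.pow_induction_on_left' with
  | algebraMap r =>
    rw [AlgHom.commutes, DirectSum.algebraMap_apply]
    congr 1
    exact Subtype.ext ((mk R M).commutes r).symm
  | add x y i hx hy ihx ihy =>
    rw [map_add, ihx, ihy, ← map_add]
    congr 1
    exact Subtype.ext (map_add (mk R M) x y).symm
  | mem_mul m hm i x hx ih =>
    obtain ⟨m, rfl⟩ := hm
    rw [map_mul, ih, decomposeExt, ExteriorAlgebra.lift_ι_apply, LinearMap.comp_apply,
      DirectSum.lof_eq_of, DirectSum.of_mul_of]
    exact DirectSum.of_eq_of_gradedMonoid_eq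
      (Sigma.subtype_ext (add_comm _ _) (map_mul (mk R M) _ _).symm)

/-- The decomposition of the Orlik-Solomon algebra into homogeneous components. -/
def decomposeOS (R : Type*) [CommRing R] (M : Matroid α) : OS R M →ₐ[R] ⨁ p, grading R M p :=
  RingQuot.liftAlgHom R ⟨decomposeExt R M, by
    rintro _ _ ⟨S, hS⟩
    rw [map_zero, decomposeExt_of_mem (boundary_eProd_mem S)]
    refine DFinsupp.single_eq_zero.mpr (Subtype.ext ?_)
    exact mk_boundary hS⟩

theorem decomposeOS_mk (x : Ext R ↥M.E) : decomposeOS R M (mk R M x) = decomposeExt R M x := by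
  unfold decomposeOS mk
  exact RingQuot.liftAlgHom_mkAlgHom_apply R _ _ x

/-- The Orlik-Solomon algebra is a graded algebra. -/
instance : GradedAlgebra (grading R M) :=
  GradedAlgebra.ofAlgHom _ (decomposeOS R M)
    (by
      refine RingQuot.ringQuot_ext' R _ _ (ExteriorAlgebra.hom_ext (LinearMap.ext fun m => ?_))
      change DirectSum.coeAlgHom (grading R M) (decomposeOS R M (mk R M (ExteriorAlgebra.ι R m)))
        = mk R M (ExteriorAlgebra.ι R m)
      rw [decomposeOS_mk, decomposeExt_of_mem (ι_mem m),
        DirectSum.coeAlgHom_of])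
    (by
      rintro p ⟨_, x, hx, rfl⟩
      change decomposeOS R M (mk R M x) = _
      rw [decomposeOS_mk, decomposeExt_of_mem hx]
      rfl)

end OrlikSolomon

/-! ### The (affine) Orlik-Solomon algebra of a pointed matroid -/

namespace PointedMatroid

open OrlikSolomon

variable (R : Type*) [CommRing R] {α : Type*} (G : PointedMatroid α)

/-- The Orlik-Solomon algebra of a pointed matroid with base point `0`: the subalgebra of the
Orlik-Solomon algebra of the underlying matroid that is generated by all `a i - a 0`. -/
def affineOS : Subalgebra R (OS R G.matroid) :=
  Algebra.adjoin R (Set.range fun i : G.Pt => a R G.matroid i - a R G.matroid G.basePt)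

/-- The generator `a i - a 0` of the affine Orlik-Solomon algebra. -/
def gen (i : G.Pt) : G.affineOS R :=
  ⟨a R G.matroid i - a R G.matroid G.basePt, Algebra.subset_adjoin ⟨i, rfl⟩⟩

/-- The grading that the affine Orlik-Solomon algebra inherits as a subalgebra. -/
def affineGrading (p : ℕ) : Submodule R (G.affineOS R) :=
  (grading R G.matroid p).comap (G.affineOS R).val.toLinearMap

variable {R G}

instance : SetLike.GradedMonoid (G.affineGrading R) where
  one_mem := SetLike.GradedOne.one_mem (A := grading R G.matroid)
  mul_mem := fun _ _ _ _ hx hy => SetLike.GradedMul.mul_mem (A := grading R G.matroid) hx hy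

theorem decompose_mem_affineOS {x : OS R G.matroid} (hx : x ∈ G.affineOS R) (p : ℕ) :
    (DirectSum.decompose (grading R G.matroid) x p : OS R G.matroid) ∈ G.affineOS R := by
  induction hx using Algebra.adjoin_induction generalizing p with
  | mem x hx =>
    obtain ⟨i, rfl⟩ := hx
    have h1 : a R G.matroid i - a R G.matroid G.basePt ∈ grading R G.matroid 1 :=
      Submodule.sub_mem _ (mk_mem_grading (e_mem i)) (mk_mem_grading (e_mem _))
    by_cases hp : 1 = p
    · subst hp
      rw [DirectSum.decompose_of_mem_same _ h1]
      exact Algebra.subset_adjoin ⟨i, rfl⟩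
    · rw [DirectSum.decompose_of_mem_ne _ h1 hp]
      exact zero_mem _
  | algebraMap r =>
    have h0 : algebraMap R (OS R G.matroid) r ∈ grading R G.matroid 0 :=
      SetLike.algebraMap_mem_graded _ r
    by_cases hp : 0 = p
    · subst hp
      rw [DirectSum.decompose_of_mem_same _ h0]
      exact Subalgebra.algebraMap_mem _ r
    · rw [DirectSum.decompose_of_mem_ne _ h0 hp]
      exact zero_mem _
  | add x y _ _ ihx ihy =>
    rw [DirectSum.decompose_add, DirectSum.add_apply, Submodule.coe_add]
    exact add_mem (ihx p) (ihy p)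
  | mul x y _ _ ihx ihy =>
    classical
    rw [DirectSum.decompose_mul, DirectSum.coe_mul_apply]
    exact sum_mem fun ij _ => mul_mem (ihx _) (ihy _)

theorem affineGrading_isInternal : DirectSum.IsInternal (G.affineGrading R) := by
  classical
  constructor
  · have hcomp : ∀ z : ⨁ p, G.affineGrading R p, ∀ q,
        ((DirectSum.decompose (grading R G.matroid)
          (DirectSum.coeAddMonoidHom (G.affineGrading R) z : OS R G.matroid) q : OS R G.matroid))
          = ((z q : G.affineOS R) : OS R G.matroid) := by
      intro z q
      induction z using DirectSum.induction_on with
      | zero => simp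
      | of p x =>
        rw [DirectSum.coeAddMonoidHom_of]
        have hx : ((x : G.affineOS R) : OS R G.matroid) ∈ grading R G.matroid p := x.2
        by_cases hp : p = q
        · subst hp
          rw [DirectSum.decompose_of_mem_same _ hx, DirectSum.of_eq_same]
        · rw [DirectSum.decompose_of_mem_ne _ hx hp, DirectSum.of_eq_of_ne _ _ _ (Ne.symm hp)]
          rfl
      | add x y hx hy => simp [DirectSum.decompose_add, hx, hy]
    intro x y hxy
    refine DFinsupp.ext fun q => Subtype.ext (Subtype.ext ?_)
    rw [← hcomp x q, ← hcomp y q, hxy]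
  · intro x
    refine ⟨∑ p ∈ (DirectSum.decompose (grading R G.matroid) (x : OS R G.matroid)).support,
      DirectSum.of (fun p => G.affineGrading R p) p
        ⟨⟨_, decompose_mem_affineOS x.2 p⟩,
          (DirectSum.decompose (grading R G.matroid) (x : OS R G.matroid) p).2⟩, ?_⟩
    rw [map_sum]
    simp only [DirectSum.coeAddMonoidHom_of]
    refine Subtype.ext ?_
    rw [AddSubmonoidClass.coe_finsetSum]
    exact DirectSum.sum_support_decompose (grading R G.matroid) (x : OS R G.matroid)

/-- The affine Orlik-Solomon algebra is a graded algebra. -/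
instance : GradedAlgebra (G.affineGrading R) where
  toDecomposition := affineGrading_isInternal.chooseDecomposition

end PointedMatroid

/-- The component of degree `n` of the (graded) tensor product of two graded algebras: the span of
all `x ⊗ y` with `x` and `y` homogeneous and `deg x + deg y = n`. -/
def tensorGrading {R A B : Type*} [CommRing R] [Ring A] [Ring B] [Algebra R A] [Algebra R B]
    (𝒜 : ℕ → Submodule R A) (ℬ : ℕ → Submodule R B) [GradedAlgebra 𝒜] [GradedAlgebra ℬ] (n : ℕ) :
    Submodule R (𝒜 ᵍ⊗[R] ℬ) :=
  Submodule.span R {t | ∃ p q : ℕ, p + q = n ∧ ∃ x ∈ 𝒜 p, ∃ y ∈ ℬ q, t = x ᵍ⊗ₜ[R] y}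

end

/-
Call a set of points of a union free if both of its parts are independent and one of them stays
independent when the base point is added. In the freest union, constructed by making the two base
points of the direct sum parallel through a principal truncation, exactly the free sets are
independent. In any union, a free set extends to a free set `J` that spans; comparison with the
freest union shows that a union of largest rank has rank at least `|J|`, so that `J` is a basis.
Thus all free sets are independent in the parallel connection.

Hence a dependent set `S` has a dependent part, or both of its parts become dependent when the base
point is added. In a family that satisfies the relations of `G₀` and of `G₁` and vanishes at the
base point, `∂ e_S` is therefore sent to zero, by the Leibniz rule for `∂`. The family
`(a i - a 0) ⊗ 1`, `1 ⊗ (a j - a 0)` is of this kind, and thus defines the inverse of `Φ`.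
-/

noncomputable section

section MatroidConstructions

open scoped Matroid

variable {α β : Type*}

theorem exists_indep_insert_insert_of_encard_lt {M : Matroid α} {F I J : Set α}
    (hI : ∃ f ∈ F, f ∉ I ∧ M.Indep (insert f I)) (hJ : ∃ f ∈ F, f ∉ J ∧ M.Indep (insert f J))
    (hIJ : I.encard < J.encard) :
    ∃ e ∈ J, e ∉ I ∧ ∃ f ∈ F, f ∉ insert e I ∧ M.Indep (insert f (insert e I)) := by
  obtain ⟨f, hfF, hfI, hI⟩ := hI
  obtain ⟨f', hf'F, hf'J, hJ⟩ := hJ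
  have augment : ∀ g ∉ I, M.Indep (insert g I) →
      ∃ e ∈ insert f' J, e ∉ insert g I ∧ M.Indep (insert g (insert e I)) := fun g hgI hg => by
    have hlt : (insert g I).encard < (insert f' J).encard := by
      rw [Set.encard_insert_of_notMem hgI, Set.encard_insert_of_notMem hf'J]
      exact (ENat.add_lt_add_iff_right ENat.one_ne_top).mpr hIJ
    obtain ⟨e, he, hi⟩ := hg.augment hJ hlt
    exact ⟨e, he.1, he.2, Set.insert_comm e g I ▸ hi⟩
  have of_mem : ∀ g ∈ F, g ∉ I → ∀ e ∈ J, e ∉ insert g I → M.Indep (insert g (insert e I)) →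
      ∃ e ∈ J, e ∉ I ∧ ∃ g ∈ F, g ∉ insert e I ∧ M.Indep (insert g (insert e I)) := by
    intro g hgF hgI e heJ he hi
    rw [Set.mem_insert_iff, not_or] at he
    exact ⟨e, heJ, he.2, g, hgF, fun h => h.elim (fun h => he.1 h.symm) hgI, hi⟩
  obtain ⟨e, rfl | heJ, he, hi⟩ := augment f hfI hI
  · have heI : e ∉ I := fun h => he (Set.mem_insert_of_mem f h)
    obtain ⟨d, rfl | hdJ, hd, hi'⟩ := augment e heI (hi.subset (Set.subset_insert f _))
    · exact absurd (Set.mem_insert d I) hd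
    · exact of_mem e hf'F heI d hdJ hd hi'
  · exact of_mem f hfF hfI e heJ he hi

/-- The principal truncation of a matroid `M` of finite rank along a set `F` that contains a
nonloop: its independent sets are the independent sets of `M` whose closure does not contain
`F`. -/
def principalTruncation (M : Matroid α) [M.RankFinite] (F : Set α) (hF : ∃ f ∈ F, M.IsNonloop f) :
    Matroid α :=
  (IndepMatroid.ofBddAugment M.E (fun I => ∃ f ∈ F, f ∉ I ∧ M.Indep (insert f I))
    (hF.imp fun f hf => ⟨hf.1, Set.notMem_empty f, by simpa using hf.2.indep⟩)
    (fun _ _ ⟨f, hfF, hfJ, hJ⟩ hIJ =>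
      ⟨f, hfF, fun hfI => hfJ (hIJ hfI), hJ.subset (Set.insert_subset_insert hIJ)⟩)
    (fun _ _ => exists_indep_insert_insert_of_encard_lt)
    ⟨M.eRank.toNat, fun I ⟨f, _, _, hI⟩ => by
      rw [ENat.natCast_toNat (M.eRank_ne_top_iff.mpr inferInstance)]
      exact (hI.subset (Set.subset_insert f I)).encard_le_eRank⟩
    fun I ⟨f, _, _, hI⟩ => (Set.subset_insert f I).trans hI.subset_ground).matroid

theorem principalTruncation_indep_iff {M : Matroid α} [M.RankFinite] {F : Set α}
    {hF : ∃ f ∈ F, M.IsNonloop f} {I : Set α} :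
    (principalTruncation M F hF).Indep I ↔ ∃ f ∈ F, f ∉ I ∧ M.Indep (insert f I) := by
  simp [principalTruncation]

instance rankFinite_sum (M : Matroid α) (N : Matroid β) [M.RankFinite] [N.RankFinite] :
    (M.sum N).RankFinite := by
  obtain ⟨B, hB⟩ := M.exists_isBase
  obtain ⟨C, hC⟩ := N.exists_isBase
  exact ⟨Sum.inl '' B ∪ Sum.inr '' C, Matroid.sum_isBase_iff.mpr
    ⟨by simpa [Set.preimage_image_eq _ Sum.inl_injective, Set.preimage_inl_image_inr] using hB, by
      simpa [Set.preimage_image_eq _ Sum.inr_injective, Set.preimage_inr_image_inl] using hC⟩,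
    (hB.finite.image _).union (hC.finite.image _)⟩

/-- The independent sets of the parallel connection of `M₀` and `M₁`, whose ground sets meet only
in `p`. -/
structure ParallelIndep (M₀ M₁ : Matroid α) (p : α) (I : Set α) : Prop where
  subset_ground : I ⊆ M₀.E ∪ M₁.E
  left : M₀.Indep (I ∩ M₀.E)
  right : M₁.Indep (I ∩ M₁.E)
  insert_or : M₀.Indep (insert p (I ∩ M₀.E)) ∨ M₁.Indep (insert p (I ∩ M₁.E))

variable {M₀ M₁ : Matroid α} {p : α} {I : Set α}

theorem ParallelIndep.symm (h : ParallelIndep M₀ M₁ p I) : ParallelIndep M₁ M₀ p I :=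
  ⟨h.subset_ground.trans (Set.union_comm _ _).subset, h.right, h.left, h.insert_or.symm⟩

open Classical in
/-- Places the points of `M₀` on the left and all other ones on the right; a common point of two
matroids thus keeps its left copy only. -/
def toSum (M₀ : Matroid α) (k : α) : α ⊕ α := if k ∈ M₀.E then .inl k else .inr k

theorem toSum_injective (M₀ : Matroid α) : Function.Injective (toSum M₀) := by
  intro k l h
  unfold toSum at h
  split_ifs at h <;> simpa using h

theorem inl_preimage_image_toSum (M₀ : Matroid α) (I : Set α) :
    Sum.inl ⁻¹' (toSum M₀ '' I) = I ∩ M₀.E := by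
  ext k
  simp only [toSum, Set.mem_preimage, Set.mem_image, Set.mem_inter_iff]
  grind

theorem inr_preimage_image_toSum (M₀ : Matroid α) (I : Set α) :
    Sum.inr ⁻¹' (toSum M₀ '' I) = I \ M₀.E := by
  ext k
  simp only [toSum, Set.mem_preimage, Set.mem_image, Set.mem_sdiff]
  grind

theorem insert_sdiff_eq_insert_inter {s t u : Set α} (hst : s ∩ t = {p}) (hu : u ⊆ s ∪ t) :
    insert p (u \ s) = insert p (u ∩ t) := by
  ext k
  have mem_both : k ∈ s ∧ k ∈ t ↔ k = p := Set.ext_iff.mp hst k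
  have mem_either : k ∈ u → k ∈ s ∨ k ∈ t := @hu k
  simp only [Set.mem_insert_iff, Set.mem_sdiff, Set.mem_inter_iff]
  tauto

/-- The parallel connection of two matroids at a common point `p`: the two copies of `p` in the
direct sum are made parallel by a principal truncation, and one of them is deleted. -/
def parallelConnection (M₀ M₁ : Matroid α) [M₀.RankFinite] [M₁.RankFinite] (p : α)
    (hp : M₀.IsNonloop p) : Matroid α :=
  (principalTruncation (M₀.sum M₁) {.inl p, .inr p} ⟨.inl p, .inl rfl, by
    rw [← Matroid.indep_singleton, Matroid.sum_indep_iff, ← Set.image_singleton,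
      Set.preimage_image_eq _ Sum.inl_injective, Set.preimage_inr_image_inl]
    exact ⟨hp.indep, M₁.empty_indep⟩⟩).comapOn (M₀.E ∪ M₁.E) (toSum M₀)

section

variable [M₀.RankFinite] [M₁.RankFinite] {hp : M₀.IsNonloop p}

theorem parallelConnection_indep_iff_sdiff :
    (parallelConnection M₀ M₁ p hp).Indep I ↔ I ⊆ M₀.E ∪ M₁.E ∧
      (p ∉ I ∧ M₀.Indep (insert p (I ∩ M₀.E)) ∧ M₁.Indep (I \ M₀.E) ∨
        M₀.Indep (I ∩ M₀.E) ∧ M₁.Indep (insert p (I \ M₀.E))) := by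
  have preimage_insert_inl (J : Set (α ⊕ α)) :
      Sum.inl ⁻¹' insert (.inl p) J = insert p (Sum.inl ⁻¹' J) ∧
        Sum.inr ⁻¹' insert (.inl p) J = Sum.inr ⁻¹' J := by
    constructor <;> ext <;> simp
  have preimage_insert_inr (J : Set (α ⊕ α)) :
      Sum.inl ⁻¹' insert (.inr p) J = Sum.inl ⁻¹' J ∧
        Sum.inr ⁻¹' insert (.inr p) J = insert p (Sum.inr ⁻¹' J) := by
    constructor <;> ext <;> simp
  have inl_mem : .inl p ∈ toSum M₀ '' I ↔ p ∈ I := by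
    rw [← Set.mem_preimage, inl_preimage_image_toSum]
    exact and_iff_left hp.mem_ground
  have inr_notMem : .inr p ∉ toSum M₀ '' I := by
    rw [← Set.mem_preimage, inr_preimage_image_toSum]
    exact fun h => h.2 hp.mem_ground
  simp only [parallelConnection, Matroid.comapOn_indep_iff, principalTruncation_indep_iff,
    Set.mem_insert_iff, Set.mem_singleton_iff, exists_eq_or_imp, exists_eq_left,
    Matroid.sum_indep_iff, preimage_insert_inl, preimage_insert_inr, inl_preimage_image_toSum,
    inr_preimage_image_toSum, inl_mem, inr_notMem, (toSum_injective M₀).injOn, not_false_eq_true,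
    true_and]
  rw [and_comm]

theorem parallelConnection_indep_iff (hE : M₀.E ∩ M₁.E = {p}) :
    (parallelConnection M₀ M₁ p hp).Indep I ↔ ParallelIndep M₀ M₁ p I := by
  have insert_sdiff (hI : I ⊆ M₀.E ∪ M₁.E) : insert p (I \ M₀.E) = insert p (I ∩ M₁.E) :=
    insert_sdiff_eq_insert_inter hE hI
  have sdiff (hI : I ⊆ M₀.E ∪ M₁.E) (hpI : p ∉ I) : I \ M₀.E = I ∩ M₁.E := by
    simpa [hpI] using congrArg (· \ {p}) (insert_sdiff hI)
  rw [parallelConnection_indep_iff_sdiff]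
  constructor
  · rintro ⟨hI, ⟨hpI, h₀, h₁⟩ | ⟨h₀, h₁⟩⟩
    · rw [sdiff hI hpI] at h₁
      exact ⟨hI, h₀.subset (Set.subset_insert _ _), h₁, .inl h₀⟩
    · rw [insert_sdiff hI] at h₁
      exact ⟨hI, h₀, h₁.subset (Set.subset_insert _ _), .inr h₁⟩
  · rintro ⟨hI, h₀, h₁, h⟩
    refine ⟨hI, ?_⟩
    rw [insert_sdiff hI]
    by_cases hpI : p ∈ I
    · have hpI₁ : p ∈ I ∩ M₁.E := ⟨hpI, (hE.symm.subset rfl).2⟩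
      exact .inr ⟨h₀, by rwa [Set.insert_eq_of_mem hpI₁]⟩
    · rw [sdiff hI hpI]
      exact h.imp (fun h => ⟨hpI, h, h₁⟩) fun h => ⟨h₀, h⟩

theorem parallelConnection_restrict_left (hE : M₀.E ∩ M₁.E = {p}) (hp₁ : M₁.IsNonloop p) :
    parallelConnection M₀ M₁ p hp ↾ M₀.E = M₀ := by
  refine Matroid.ext_indep rfl fun I (hI : I ⊆ M₀.E) => ?_
  have inter_subset : I ∩ M₁.E ⊆ {p} := hE ▸ Set.inter_subset_inter_left M₁.E hI
  rw [Matroid.restrict_indep_iff, parallelConnection_indep_iff hE, and_iff_left hI]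
  refine ⟨fun h => Set.inter_eq_left.mpr hI ▸ h.left, fun h => ?_⟩
  exact ⟨hI.trans Set.subset_union_left, by rwa [Set.inter_eq_left.mpr hI],
    hp₁.indep.subset inter_subset, .inr (hp₁.indep.subset (Set.insert_subset rfl inter_subset))⟩

theorem parallelConnection_restrict_right (hE : M₀.E ∩ M₁.E = {p}) :
    parallelConnection M₀ M₁ p hp ↾ M₁.E = M₁ := by
  refine Matroid.ext_indep rfl fun I (hI : I ⊆ M₁.E) => ?_
  have inter_subset : I ∩ M₀.E ⊆ {p} :=
    hE ▸ Set.inter_comm M₁.E _ ▸ Set.inter_subset_inter_left M₀.E hI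
  rw [Matroid.restrict_indep_iff, parallelConnection_indep_iff hE, and_iff_left hI]
  refine ⟨fun h => Set.inter_eq_left.mpr hI ▸ h.right, fun h => ?_⟩
  exact ⟨hI.trans Set.subset_union_right, hp.indep.subset inter_subset,
    by rwa [Set.inter_eq_left.mpr hI],
    .inl (hp.indep.subset (Set.insert_subset rfl inter_subset))⟩

end

section

variable {M : Matroid α} {s t : Set α}

theorem parallelIndep_of_isBasis {B C : Set α} (hst : s ∩ t = {p}) (hB : M.IsBasis B s)
    (hC : M.IsBasis C t) (hpB : p ∈ B) : ParallelIndep (M ↾ s) (M ↾ t) p (B \ {p} ∪ C) := by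
  have mem_both : ∀ k ∈ s, k ∈ t → k = p := fun k hks hkt => hst.subset ⟨hks, hkt⟩
  have inter_s : insert p ((B \ {p} ∪ C) ∩ s) ⊆ B := by
    rintro k (rfl | ⟨hk | hk, hks⟩)
    · exact hpB
    · exact hk.1
    · exact mem_both k hks (hC.subset hk) ▸ hpB
  have inter_t : (B \ {p} ∪ C) ∩ t ⊆ C := by
    rintro k ⟨hk | hk, hkt⟩
    · exact absurd (mem_both k (hB.subset hk.1) hkt) hk.2
    · exact hk
  have restrict_indep {r J K : Set α} (hK : M.IsBasis K r) (hJK : J ⊆ K) : (M ↾ r).Indep J :=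
    (hK.indep.subset hJK).indep_restrict_of_subset (hJK.trans hK.subset)
  exact ⟨Set.union_subset_union (Set.sdiff_subset.trans hB.subset) hC.subset,
    restrict_indep hB ((Set.subset_insert p _).trans inter_s), restrict_indep hC inter_t,
    .inl (restrict_indep hB inter_s)⟩

theorem spanning_sdiff_union_of_isBasis {B C : Set α} (hst : s ∪ t = M.E) (hB : M.IsBasis B s)
    (hC : M.IsBasis C t) (hpt : p ∈ t) : M.Spanning (B \ {p} ∪ C) := by
  have subset_ground : B \ {p} ∪ C ⊆ M.E :=
    Set.union_subset (Set.sdiff_subset.trans hB.indep.subset_ground) hC.indep.subset_ground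
  have t_subset : t ⊆ M.closure (B \ {p} ∪ C) :=
    hC.subset_closure.trans (M.closure_subset_closure Set.subset_union_right)
  have B_subset : B ⊆ M.closure (B \ {p} ∪ C) := by
    intro k hk
    by_cases hkp : k = p
    · exact hkp ▸ t_subset hpt
    · exact M.mem_closure_of_mem (.inl ⟨hk, hkp⟩) subset_ground
  rw [Matroid.spanning_iff_ground_subset_closure subset_ground, ← hst]
  exact Set.union_subset (hB.subset_closure.trans
    (M.closure_subset_closure_of_subset_closure B_subset)) t_subset

theorem ParallelIndep.exists_spanning_superset (hst : s ∪ t = M.E) (hp : s ∩ t = {p})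
    (hI : ParallelIndep (M ↾ s) (M ↾ t) p I) :
    ∃ J, I ⊆ J ∧ ParallelIndep (M ↾ s) (M ↾ t) p J ∧ M.Spanning J := by
  wlog hps : M.Indep (insert p (I ∩ s)) generalizing s t
  · have hpt : M.Indep (insert p (I ∩ t)) :=
      (hI.insert_or.resolve_left fun h => hps h.of_restrict).of_restrict
    obtain ⟨J, hIJ, hJ, hJspan⟩ :=
      this (Set.union_comm s t ▸ hst) (Set.inter_comm s t ▸ hp) hI.symm hpt
    exact ⟨J, hIJ, hJ.symm, hJspan⟩
  obtain ⟨hp_s, hp_t⟩ : p ∈ s ∩ t := hp.symm.subset rfl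
  obtain ⟨B, hB, hIB⟩ := hps.subset_isBasis_of_subset
    (Set.insert_subset hp_s Set.inter_subset_right) (hst ▸ Set.subset_union_left)
  obtain ⟨C, hC, hIC⟩ := hI.right.of_restrict.subset_isBasis_of_subset
    Set.inter_subset_right (hst ▸ Set.subset_union_right)
  refine ⟨B \ {p} ∪ C, fun k hk => ?_, parallelIndep_of_isBasis hp hB hC (hIB (.inl rfl)),
    spanning_sdiff_union_of_isBasis hst hB hC hp_t⟩
  by_cases hkt : k ∈ t
  · exact .inr (hIC ⟨hk, hkt⟩)
  · have hks : k ∈ s := (hI.subset_ground hk).resolve_right hkt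
    exact .inl ⟨hIB (.inr ⟨hk, hks⟩), fun hkp => hkt (hkp ▸ hp_t)⟩

theorem ParallelIndep.isNonloop (hI : ParallelIndep (M ↾ s) (M ↾ t) p I) : M.IsNonloop p := by
  rw [← Matroid.indep_singleton]
  exact hI.insert_or.elim
    (fun h => h.of_restrict.subset (Set.singleton_subset_iff.mpr (Set.mem_insert p _)))
    (fun h => h.of_restrict.subset (Set.singleton_subset_iff.mpr (Set.mem_insert p _)))

theorem ParallelIndep.indep_of_eRank_maximal [M.RankFinite] (hst : s ∪ t = M.E) (hp : s ∩ t = {p})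
    (hmax : ∀ N : Matroid α, N.E = M.E → N ↾ s = M ↾ s → N ↾ t = M ↾ t → N.eRank ≤ M.eRank)
    (hI : ParallelIndep (M ↾ s) (M ↾ t) p I) : M.Indep I := by
  obtain ⟨J, hIJ, hJ, hJspan⟩ := hI.exists_spanning_superset hst hp
  have hs : (M ↾ s).IsNonloop p :=
    Matroid.restrict_isNonloop_iff.mpr ⟨hI.isNonloop, (hp.symm.subset rfl).1⟩
  have ht : (M ↾ t).IsNonloop p :=
    Matroid.restrict_isNonloop_iff.mpr ⟨hI.isNonloop, (hp.symm.subset rfl).2⟩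
  let N := parallelConnection (M ↾ s) (M ↾ t) p hs
  have hN : N.eRank ≤ M.eRank := hmax N hst (parallelConnection_restrict_left hp ht)
    (parallelConnection_restrict_right hp)
  have hJN : N.Indep J := (parallelConnection_indep_iff hp).mpr hJ
  refine ((M.isRkFinite_set J).indep_of_encard_le_eRk ?_).subset hIJ
  exact hJspan.eRk_eq ▸ hJN.encard_le_eRank.trans hN

end

end MatroidConstructions

namespace PointedMatroid

open scoped Matroid

variable {α β γ : Type*} {G : PointedMatroid α} {G₀ : PointedMatroid α} {G₁ : PointedMatroid β}
  {P : PointedMatroid γ} {f : G.Pt → P.Pt} {f₀ : G₀.Pt → P.Pt} {f₁ : G₁.Pt → P.Pt}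

/-- The matroid of `G`, transported to its type of points. -/
def pts (G : PointedMatroid α) : Matroid G.Pt := G.matroid.restrictSubtype G.matroid.E

theorem pts_indep_iff {I : Set G.Pt} : G.pts.Indep I ↔ G.matroid.Indep ((↑) '' I) :=
  Matroid.restrictSubtype_indep_iff

theorem pts_ground : G.pts.E = Set.univ := Subtype.coe_preimage_self G.matroid.E

theorem eRank_pts : G.pts.eRank = G.matroid.eRank :=
  (Matroid.eRank_map G.pts Subtype.val_injective.injOn).symm.trans
    (congrArg Matroid.eRank (Matroid.map_val_restrictSubtype_ground_eq G.matroid))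

theorem IsEmbedding.pts_indep_image_iff (hf : G.IsEmbedding P f) {I : Set G.Pt} :
    P.pts.Indep (f '' I) ↔ G.pts.Indep I := by
  rw [pts_indep_iff, pts_indep_iff, Set.image_image, hf.indep_iff]

theorem IsUnion.symm (h : G₀.IsUnion G₁ P f₀ f₁) : G₁.IsUnion G₀ P f₁ f₀ :=
  ⟨h.right, h.left, Set.union_comm _ _ ▸ h.union_eq, Set.inter_comm _ _ ▸ h.inter_eq⟩

theorem IsEmbedding.isRkFinite_range [G.matroid.RankFinite] (hf : G.IsEmbedding P f) :
    P.pts.IsRkFinite (Set.range f) := by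
  obtain ⟨I, hI⟩ := P.pts.exists_isBasis (Set.range f) (pts_ground ▸ Set.subset_univ _)
  refine hI.isRkFinite_of_finite ?_
  obtain ⟨J, rfl⟩ := Set.subset_range_iff_exists_image_eq.mp hI.subset
  have hJ : (((↑) : G.Pt → α) '' J).Finite :=
    (pts_indep_iff.mp (hf.pts_indep_image_iff.mp hI.indep)).finite
  exact (hJ.of_finite_image Subtype.val_injective.injOn).image f

theorem IsUnion.rankFinite_pts [G₀.matroid.RankFinite] [G₁.matroid.RankFinite]
    (h : G₀.IsUnion G₁ P f₀ f₁) : P.pts.RankFinite := by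
  rw [← Matroid.isRkFinite_ground_iff_rankFinite, pts_ground, ← h.union_eq]
  exact h.left.isRkFinite_range.union h.right.isRkFinite_range

/-- The pointed matroid with the points and the base point of `P`, and with the independent sets
of `N`. -/
def withMatroid (P : PointedMatroid γ) (N : Matroid P.Pt) (hN : N.E = Set.univ) :
    PointedMatroid γ where
  matroid := N.map (↑) Subtype.val_injective.injOn
  base := P.base
  base_mem := ⟨P.basePt, hN.superset (Set.mem_univ _), rfl⟩

/-- The identity map, from the points of `P` to those of `P.withMatroid N hN`. -/
def toWithMatroid (N : Matroid P.Pt) (hN : N.E = Set.univ) (k : P.Pt) : (P.withMatroid N hN).Pt :=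
  ⟨k, k, hN.superset (Set.mem_univ k), rfl⟩

section

variable {N : Matroid P.Pt} {hN : N.E = Set.univ}

theorem toWithMatroid_bijective : Function.Bijective (toWithMatroid N hN) :=
  ⟨fun _ _ h => Subtype.ext (Subtype.mk.inj h), fun ⟨_, k, _, hk⟩ => ⟨k, Subtype.ext hk⟩⟩

theorem IsEmbedding.toWithMatroid_comp (hf : G.IsEmbedding P f)
    (h : N ↾ Set.range f = P.pts ↾ Set.range f) :
    G.IsEmbedding (P.withMatroid N hN) (toWithMatroid N hN ∘ f) where
  injective := toWithMatroid_bijective.injective.comp hf.injective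
  map_base := congrArg (toWithMatroid N hN) hf.map_base
  indep_iff I := by
    have hI : f '' I ⊆ Set.range f := Set.image_subset_range f I
    calc (P.withMatroid N hN).matroid.Indep ((fun i : G.Pt => (f i : γ)) '' I)
        ↔ (N.map (↑) Subtype.val_injective.injOn).Indep (((↑) : P.Pt → γ) '' (f '' I)) := by
          rw [Set.image_image]; rfl
      _ ↔ N.Indep (f '' I) := Matroid.map_image_indep_iff (hN.symm ▸ Set.subset_univ _)
      _ ↔ (N ↾ Set.range f).Indep (f '' I) := (N.restrict_indep_iff.trans (and_iff_left hI)).symm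
      _ ↔ P.pts.Indep (f '' I) := by rw [h, Matroid.restrict_indep_iff, and_iff_left hI]
      _ ↔ G.matroid.Indep ((fun i : G.Pt => (i : α)) '' I) := by
          rw [hf.pts_indep_image_iff, pts_indep_iff]

theorem IsUnion.toWithMatroid_comp (h : G₀.IsUnion G₁ P f₀ f₁)
    (h₀ : N ↾ Set.range f₀ = P.pts ↾ Set.range f₀) (h₁ : N ↾ Set.range f₁ = P.pts ↾ Set.range f₁) :
    G₀.IsUnion G₁ (P.withMatroid N hN) (toWithMatroid N hN ∘ f₀) (toWithMatroid N hN ∘ f₁) where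
  left := h.left.toWithMatroid_comp h₀
  right := h.right.toWithMatroid_comp h₁
  union_eq := by
    rw [Set.range_comp, Set.range_comp, ← Set.image_union, h.union_eq, Set.image_univ,
      toWithMatroid_bijective.surjective.range_eq]
  inter_eq := by
    rw [Set.range_comp, Set.range_comp, ← Set.image_inter toWithMatroid_bijective.injective,
      h.inter_eq, Set.image_singleton]
    rfl

end

/-- `P` is the freest union of `G₀` and `G₁`: every set of points is independent unless
independence on the two sides forbids it. Unlike `IsParallelConnection`, this notion does not refer
to the rank. -/
structure IsFreeUnion (G₀ : PointedMatroid α) (G₁ : PointedMatroid β) (P : PointedMatroid γ)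
    (f₀ : G₀.Pt → P.Pt) (f₁ : G₁.Pt → P.Pt) : Prop extends G₀.IsUnion G₁ P f₀ f₁ where
  indep_of_parallelIndep : ∀ I : Set P.Pt,
    ParallelIndep (P.pts ↾ Set.range f₀) (P.pts ↾ Set.range f₁) P.basePt I → P.pts.Indep I

theorem IsParallelConnection.isFreeUnion [G₀.matroid.RankFinite] [G₁.matroid.RankFinite]
    (h : G₀.IsParallelConnection G₁ P f₀ f₁) : G₀.IsFreeUnion G₁ P f₀ f₁ where
  toIsUnion := h.isUnion
  indep_of_parallelIndep I hI := by
    have : P.pts.RankFinite := h.isUnion.rankFinite_pts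
    have hground : Set.range f₀ ∪ Set.range f₁ = P.pts.E := h.isUnion.union_eq.trans pts_ground.symm
    refine hI.indep_of_eRank_maximal hground h.isUnion.inter_eq fun N hN h₀ h₁ => ?_
    have hN : N.E = Set.univ := hN.trans pts_ground
    calc N.eRank = (P.withMatroid N hN).matroid.eRank :=
          (Matroid.eRank_map N Subtype.val_injective.injOn).symm
      _ ≤ P.matroid.eRank := h.eRank_le _ _ _ (h.isUnion.toWithMatroid_comp h₀ h₁)
      _ = P.pts.eRank := eRank_pts.symm

end PointedMatroid

namespace OrlikSolomon

variable {R : Type*} [CommRing R] {X Y : Type*} {A B : Type*} [Ring A] [Algebra R A]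
  [Ring B] [Algebra R B]

section Ext

theorem eProd_cons (i : X) (S : List X) : eProd R (i :: S) = e R i * eProd R S :=
  List.prod_cons

theorem eProd_append (S T : List X) : eProd R (S ++ T) = eProd R S * eProd R T := by
  rw [eProd, List.map_append, List.prod_append, eProd, eProd]

theorem boundary_ι_mul (m : X →₀ R) (x : Ext R X) :
    boundary R X (ExteriorAlgebra.ι R m * x) =
      Finsupp.linearCombination R (fun _ => (1 : R)) m • x
        - ExteriorAlgebra.ι R m * boundary R X x :=
  CliffordAlgebra.contractLeft_ι_mul _ _ _

theorem boundary_algebraMap (r : R) : boundary R X (algebraMap R _ r) = 0 :=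
  CliffordAlgebra.contractLeft_algebraMap _ _ r

theorem boundary_boundary (x : Ext R X) : boundary R X (boundary R X x) = 0 :=
  CliffordAlgebra.contractLeft_contractLeft _ x

theorem boundary_eProd_mul (S : List X) (y : Ext R X) :
    boundary R X (eProd R S * y) =
      boundary R X (eProd R S) * y + (-1 : R) ^ S.length • (eProd R S * boundary R X y) := by
  induction S with
  | nil => simp [eProd, boundary]
  | cons i S ih =>
    simp only [eProd_cons, mul_assoc, boundary_e_mul, ih, List.length_cons, pow_succ, sub_mul,
      mul_add, mul_neg, mul_one, neg_smul, mul_smul_comm]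
    abel

theorem e_mul_e_swap (i j : X) : e R i * e R j = -(e R j * e R i) :=
  eq_neg_of_add_eq_zero_left (ExteriorAlgebra.ι_add_mul_swap _ _)

theorem eProd_perm {S T : List X} (h : S.Perm T) :
    eProd R S = eProd R T ∨ eProd R S = -eProd R T := by
  induction h with
  | nil => exact .inl rfl
  | cons i _ ih =>
    simp only [eProd_cons]
    exact ih.imp (congrArg _) fun h => by rw [h, mul_neg]
  | swap i j S =>
    right
    simp only [eProd_cons, ← mul_assoc, e_mul_e_swap j i, neg_mul]
  | trans _ _ ih ih' => rcases ih with h | h <;> rcases ih' with h' | h' <;> simp [h, h']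

theorem eProd_eq_e_mul_boundary {i : X} {S : List X} (hi : i ∈ S) :
    eProd R S = e R i * boundary R X (eProd R S) := by
  classical
  have e_mul_eProd : e R i * eProd R S = 0 := by
    have e_mul_cons (T : List X) : e R i * eProd R (i :: T) = 0 := by
      rw [eProd_cons, ← mul_assoc, e, ExteriorAlgebra.ι_sq_zero, zero_mul]
    rcases eProd_perm (R := R) (List.perm_cons_erase hi) with h | h <;> simp [h, e_mul_cons]
  rw [← sub_eq_zero, ← boundary_e_mul, e_mul_eProd, map_zero]

theorem mul_comm_of_mem_exteriorPower {M : Type*} [AddCommGroup M] [Module R M] {p q : ℕ}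
    {x y : ExteriorAlgebra R M} (hx : x ∈ ⋀[R]^p M) (hy : y ∈ ⋀[R]^q M) :
    x * y = (-1 : ℤˣ) ^ (q * p) • (y * x) := by
  have mem_evenOdd {n : ℕ} {z : ExteriorAlgebra R M} (hz : z ∈ ⋀[R]^n M) :
      z ∈ CliffordAlgebra.evenOdd (0 : QuadraticForm R M) n :=
    le_iSup (fun j : {k : ℕ // (k : ZMod 2) = n} =>
      LinearMap.range (CliffordAlgebra.ι (0 : QuadraticForm R M)) ^ (j : ℕ)) ⟨n, rfl⟩ hz
  have h := CliffordAlgebra.map_mul_map_of_isOrtho_of_mem_evenOdd (.id 0) (.id 0)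
    (fun _ _ => by simp [QuadraticMap.IsOrtho]) x y (mem_evenOdd hx) (mem_evenOdd hy)
  rwa [CliffordAlgebra.map_id, ← Nat.cast_mul, uzpow_natCast] at h

end Ext

section IsExterior

theorem pow_one_le_of_gradedMonoid (𝒞 : ℕ → Submodule R A) [SetLike.GradedMonoid 𝒞] (p : ℕ) :
    𝒞 1 ^ p ≤ 𝒞 p := by
  induction p with
  | zero => exact (pow_zero (𝒞 1)).trans_le (Submodule.one_le.mpr SetLike.GradedOne.one_mem)
  | succ p ih =>
    rw [pow_succ, Submodule.mul_le]
    exact fun x hx y hy => SetLike.GradedMul.mul_mem (ih hx) hy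

theorem linearCombination_sub_const (g : X → A) (a : A) (m : X →₀ R) :
    Finsupp.linearCombination R (fun i => g i - a) m =
      Finsupp.linearCombination R g m - Finsupp.linearCombination R (fun _ => (1 : R)) m • a := by
  simp [Finsupp.linearCombination_apply, Finsupp.sum, smul_sub, Finset.sum_smul]

variable (R) in
/-- The elements `g i` anticommute and square to zero. This is encoded as the single requirement
that all of their linear combinations square to zero, the form in which the universal property of
the exterior algebra uses it. -/
def IsExterior (g : X → A) : Prop :=
  ∀ m : X →₀ R, Finsupp.linearCombination R g m * Finsupp.linearCombination R g m = 0

namespace IsExterior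

variable {g : X → A}

theorem map (hg : IsExterior R g) (φ : A →ₐ[R] B) : IsExterior R (φ ∘ g) := fun m => by
  rw [← AlgHom.coe_toLinearMap, ← Finsupp.apply_linearCombination, AlgHom.toLinearMap_apply,
    ← map_mul, hg, map_zero]

theorem comp (hg : IsExterior R g) (f : Y → X) : IsExterior R (g ∘ f) := fun m => by
  rw [← Finsupp.linearCombination_mapDomain, hg]

/-- The homomorphism from the exterior algebra that sends `e i` to `g i`. -/
def lift (hg : IsExterior R g) : Ext R X →ₐ[R] A :=
  ExteriorAlgebra.lift R ⟨Finsupp.linearCombination R g, hg⟩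

theorem lift_ι (hg : IsExterior R g) (m : X →₀ R) :
    hg.lift (ExteriorAlgebra.ι R m) = Finsupp.linearCombination R g m :=
  ExteriorAlgebra.lift_ι_apply R _ _ m

theorem lift_e (hg : IsExterior R g) (i : X) : hg.lift (e R i) = g i := by
  rw [e, lift_ι, Finsupp.linearCombination_single, one_smul]

theorem eq_lift (hg : IsExterior R g) {φ : Ext R X →ₐ[R] A} (h : ∀ i, φ (e R i) = g i) :
    φ = hg.lift :=
  ExteriorAlgebra.hom_ext <| Finsupp.lhom_ext' fun i => LinearMap.ext_ring <|
    (h i).trans (hg.lift_e i).symm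

theorem lift_map (hg : IsExterior R g) (φ : A →ₐ[R] B) : (hg.map φ).lift = φ.comp hg.lift :=
  ((hg.map φ).eq_lift fun i => congrArg φ (hg.lift_e i)).symm

theorem lift_eProd_map (hg : IsExterior R g) (f : Y → X) (S : List Y) :
    hg.lift (eProd R (S.map f)) = (hg.comp f).lift (eProd R S) := by
  simp only [eProd, map_list_prod, List.map_map, Function.comp_def, lift_e]

theorem lift_boundary_eProd_map (hg : IsExterior R g) (f : Y → X) (S : List Y) :
    hg.lift (boundary R X (eProd R (S.map f))) =
      (hg.comp f).lift (boundary R Y (eProd R S)) := by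
  induction S with
  | nil => simp [eProd, boundary]
  | cons i S ih =>
    simp only [List.map_cons, eProd_cons, boundary_e_mul, map_sub, map_mul, lift_eProd_map, lift_e,
      ih, Function.comp_apply]

theorem sub_const (hg : IsExterior R g) (k : X) : IsExterior R fun i => g i - g k := fun m => by
  have h : Finsupp.linearCombination R (fun i => g i - g k) m =
      Finsupp.linearCombination R g
        (m - .single k (Finsupp.linearCombination R (fun _ => 1) m)) := by
    rw [linearCombination_sub_const, map_sub, Finsupp.linearCombination_single]
  rw [h, hg]

theorem lift_mem (hg : IsExterior R g) {𝒞 : ℕ → Submodule R A} [SetLike.GradedMonoid 𝒞]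
    (h : ∀ i, g i ∈ 𝒞 1) {p : ℕ} {x : Ext R X} (hx : x ∈ ⋀[R]^p (X →₀ R)) :
    hg.lift x ∈ 𝒞 p := by
  have map_range_ι :
      (LinearMap.range (ExteriorAlgebra.ι R)).map hg.lift.toLinearMap ≤ 𝒞 1 := by
    rintro _ ⟨_, ⟨m, rfl⟩, rfl⟩
    rw [AlgHom.toLinearMap_apply, lift_ι]
    exact Submodule.sum_smul_mem (𝒞 1) m fun i _ => h i
  have map_exteriorPower : (⋀[R]^p (X →₀ R)).map hg.lift.toLinearMap ≤ 𝒞 1 ^ p := by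
    rw [ExteriorAlgebra.exteriorPower, Submodule.map_pow]
    exact pow_le_pow_left' map_range_ι p
  exact pow_one_le_of_gradedMonoid 𝒞 p (map_exteriorPower ⟨x, hx, rfl⟩)

end IsExterior

theorem linearCombination_e (m : X →₀ R) :
    Finsupp.linearCombination R (e R) m = ExteriorAlgebra.ι R m :=
  LinearMap.congr_fun (Finsupp.lhom_ext' fun i => LinearMap.ext_ring (by simp [e])) m

theorem isExterior_e : IsExterior R (e R : X → Ext R X) := fun m => by
  rw [linearCombination_e, ExteriorAlgebra.ι_sq_zero]

theorem lift_e_sub_e (k : X) (x : Ext R X) :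
    (isExterior_e.sub_const k).lift x = x - e R k * boundary R X x := by
  induction x using CliffordAlgebra.left_induction with
  | algebraMap r => rw [AlgHom.commutes, boundary_algebraMap, mul_zero, sub_zero]
  | add x y hx hy => rw [map_add, map_add, hx, hy, mul_add, add_sub_add_comm]
  | ι_mul x m hx =>
    change (isExterior_e.sub_const k).lift (ExteriorAlgebra.ι R m * x) =
      ExteriorAlgebra.ι R m * x - e R k * boundary R X (ExteriorAlgebra.ι R m * x)
    have swap (y : Ext R X) :
        e R k * (ExteriorAlgebra.ι R m * y) = -(ExteriorAlgebra.ι R m * (e R k * y)) := by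
      rw [← mul_assoc, e, eq_neg_of_add_eq_zero_left (ExteriorAlgebra.ι_add_mul_swap _ m), neg_mul,
        mul_assoc]
    have sq (y : Ext R X) : e R k * (e R k * y) = 0 := by
      rw [← mul_assoc, e, ExteriorAlgebra.ι_sq_zero, zero_mul]
    rw [map_mul, hx, IsExterior.lift_ι, linearCombination_sub_const, linearCombination_e,
      boundary_ι_mul, sub_mul, mul_sub, mul_sub, mul_sub, swap, smul_mul_assoc, smul_mul_assoc, sq,
      mul_smul_comm, smul_zero]
    abel

theorem lift_e_sub_e_boundary (k : X) (x : Ext R X) :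
    (isExterior_e.sub_const k).lift (boundary R X x) = boundary R X x := by
  rw [lift_e_sub_e, boundary_boundary, mul_zero, sub_zero]

end IsExterior

section Vanishing

variable {φ : Ext R X →ₐ[R] A} {S T : List X}

theorem map_eProd_eq_zero (hS : S ≠ []) (h : φ (boundary R X (eProd R S)) = 0) :
    φ (eProd R S) = 0 := by
  obtain ⟨i, hi⟩ := List.exists_mem_of_ne_nil S hS
  rw [eProd_eq_e_mul_boundary hi, map_mul, h, mul_zero]

theorem map_eProd_eq_zero_of_cons {k : X} (hk : φ (e R k) = 0)
    (h : φ (boundary R X (eProd R (k :: S))) = 0) : φ (eProd R S) = 0 := by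
  rwa [eProd_cons, boundary_e_mul, map_sub, map_mul, hk, zero_mul, sub_zero] at h

theorem map_boundary_eProd_append (hS : φ (eProd R S) = 0) :
    φ (boundary R X (eProd R (S ++ T))) = φ (boundary R X (eProd R S)) * φ (eProd R T) := by
  rw [eProd_append, boundary_eProd_mul, map_add, map_smul, map_mul, map_mul, hS, zero_mul,
    smul_zero, add_zero]

theorem map_boundary_eProd_perm (hST : S.Perm T) (h : φ (boundary R X (eProd R S)) = 0) :
    φ (boundary R X (eProd R T)) = 0 := by
  rcases eProd_perm (R := R) hST.symm with hT | hT
  · rw [hT, h]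
  · rw [hT, map_neg, map_neg, h, neg_zero]

theorem map_boundary_eProd_eq_zero_of_filter (p : X → Prop) [DecidablePred p]
    (hp : φ (eProd R (S.filter p)) = 0)
    (h : φ (boundary R X (eProd R (S.filter p))) * φ (eProd R (S.filter (¬ p ·))) = 0) :
    φ (boundary R X (eProd R S)) = 0 := by
  have hperm : (S.filter p ++ S.filter (¬ p ·)).Perm S := by
    simpa only [decide_not] using List.filter_append_perm (p ·) S
  exact map_boundary_eProd_perm hperm ((map_boundary_eProd_append hp).trans h)

end Vanishing

section IsOSFamily

variable {α β : Type*} {M : Matroid α} {N : Matroid β}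

theorem isDependent_iff_not_indep {S : List M.E} :
    IsDependent M S ↔ ¬ M.Indep ((↑) '' {i | i ∈ S}) :=
  (Matroid.not_indep_iff (Subtype.coe_image_subset M.E _)).symm

theorem IsDependent.ne_nil {S : List M.E} (hS : IsDependent M S) : S ≠ [] := by
  rintro rfl
  simp [isDependent_iff_not_indep] at hS

variable (R M) in
/-- The elements `g i` satisfy the relations between the generators `a i` of the Orlik-Solomon
algebra of `M`. -/
structure IsOSFamily (g : M.E → A) : Prop where
  isExterior : IsExterior R g
  lift_boundary : ∀ S, IsDependent M S → isExterior.lift (boundary R M.E (eProd R S)) = 0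

theorem isExterior_a : IsExterior R (a R M) := isExterior_e.map (mk R M)

theorem isExterior_a_lift : (isExterior_a (R := R) (M := M)).lift = mk R M :=
  (isExterior_a.eq_lift fun _ => rfl).symm

theorem isOSFamily_a : IsOSFamily R M (a R M) where
  isExterior := isExterior_a
  lift_boundary S hS := by rw [isExterior_a_lift, mk_boundary hS]

namespace IsOSFamily

variable {g : M.E → A}

theorem map (hg : IsOSFamily R M g) (φ : A →ₐ[R] B) : IsOSFamily R M (φ ∘ g) where
  isExterior := hg.isExterior.map φ
  lift_boundary S hS := by
    rw [hg.isExterior.lift_map, AlgHom.comp_apply, hg.lift_boundary S hS, map_zero]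

theorem of_map {φ : A →ₐ[R] B} (hφ : Function.Injective φ) (hg : IsOSFamily R M (φ ∘ g)) :
    IsOSFamily R M g :=
  have isExterior : IsExterior R g := fun m => hφ <| by
    have h := hg.isExterior m
    rwa [← AlgHom.coe_toLinearMap, ← Finsupp.apply_linearCombination, AlgHom.toLinearMap_apply,
      ← map_mul, ← map_zero φ] at h
  { isExterior
    lift_boundary := fun S hS => hφ <| by
      have h := hg.lift_boundary S hS
      rwa [isExterior.lift_map, AlgHom.comp_apply, ← map_zero φ] at h }

theorem comp (hg : IsOSFamily R M g) {f : N.E → M.E}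
    (hf : ∀ S, IsDependent N S → IsDependent M (S.map f)) : IsOSFamily R N (g ∘ f) where
  isExterior := hg.isExterior.comp f
  lift_boundary S hS := by
    rw [← hg.isExterior.lift_boundary_eProd_map, hg.lift_boundary _ (hf S hS)]

theorem sub_const (hg : IsOSFamily R M g) (k : M.E) : IsOSFamily R M fun i => g i - g k where
  isExterior := hg.isExterior.sub_const k
  lift_boundary S hS := by
    have h : (hg.isExterior.sub_const k).lift =
        hg.isExterior.lift.comp (isExterior_e.sub_const k).lift :=
      ((hg.isExterior.sub_const k).eq_lift fun i => by
        simp only [AlgHom.comp_apply, IsExterior.lift_e, map_sub]).symm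
    rw [h, AlgHom.comp_apply, lift_e_sub_e_boundary, hg.lift_boundary S hS]

/-- The homomorphism from the Orlik-Solomon algebra that sends `a i` to `g i`. -/
def lift (hg : IsOSFamily R M g) : OS R M →ₐ[R] A :=
  RingQuot.liftAlgHom R ⟨hg.isExterior.lift, by
    rintro _ _ ⟨S, hS⟩
    rw [hg.lift_boundary S hS, map_zero]⟩

theorem lift_mk (hg : IsOSFamily R M g) (x : Ext R M.E) :
    hg.lift (OrlikSolomon.mk R M x) = hg.isExterior.lift x :=
  RingQuot.liftAlgHom_mkAlgHom_apply R _ _ x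

theorem lift_a (hg : IsOSFamily R M g) (i : M.E) : hg.lift (a R M i) = g i := by
  rw [a, lift_mk, IsExterior.lift_e]

theorem lift_mem (hg : IsOSFamily R M g) {𝒞 : ℕ → Submodule R A} [SetLike.GradedMonoid 𝒞]
    (h : ∀ i, g i ∈ 𝒞 1) {p : ℕ} {x : OS R M} (hx : x ∈ grading R M p) : hg.lift x ∈ 𝒞 p := by
  obtain ⟨x, hx, rfl⟩ := hx
  rw [AlgHom.toLinearMap_apply, lift_mk]
  exact hg.isExterior.lift_mem h hx

end IsOSFamily

theorem mul_comm_of_mem_grading {p q : ℕ} {x y : OS R M} (hx : x ∈ grading R M p)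
    (hy : y ∈ grading R M q) : x * y = (-1 : ℤˣ) ^ (q * p) • (y * x) := by
  obtain ⟨x, hx, rfl⟩ := hx
  obtain ⟨y, hy, rfl⟩ := hy
  simp only [AlgHom.toLinearMap_apply]
  rw [← map_mul, mul_comm_of_mem_exteriorPower hx hy, Units.smul_def, Units.smul_def, map_zsmul,
    map_mul]

end IsOSFamily

end OrlikSolomon

section GradedTensorProduct

open OrlikSolomon

variable {R A B : Type*} [CommRing R] [Ring A] [Ring B] [Algebra R A] [Algebra R B]
  {𝒜 : ℕ → Submodule R A} {ℬ : ℕ → Submodule R B} [GradedAlgebra 𝒜] [GradedAlgebra ℬ]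

theorem tmul_mul_tmul_of_mem {q p' : ℕ} (x : A) {y : B} {x' : A} (y' : B) (hy : y ∈ ℬ q)
    (hx' : x' ∈ 𝒜 p') :
    (x ᵍ⊗ₜ[R] y * x' ᵍ⊗ₜ[R] y' : 𝒜 ᵍ⊗[R] ℬ) =
      (-1 : ℤˣ) ^ (q * p') • ((x * x') ᵍ⊗ₜ[R] (y * y')) :=
  GradedTensorProduct.tmul_coe_mul_coe_tmul 𝒜 ℬ x ⟨y, hy⟩ ⟨x', hx'⟩ y'

theorem tmul_mem_tensorGrading {p q : ℕ} {x : A} {y : B} (hx : x ∈ 𝒜 p) (hy : y ∈ ℬ q) :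
    x ᵍ⊗ₜ[R] y ∈ tensorGrading 𝒜 ℬ (p + q) :=
  Submodule.subset_span ⟨p, q, rfl, x, hx, y, hy, rfl⟩

instance : SetLike.GradedMonoid (tensorGrading 𝒜 ℬ) where
  one_mem := by
    have h : (1 : A) ᵍ⊗ₜ[R] (1 : B) ∈ tensorGrading 𝒜 ℬ (0 + 0) :=
      tmul_mem_tensorGrading SetLike.GradedOne.one_mem SetLike.GradedOne.one_mem
    exact h
  mul_mem m n s t hs ht := by
    have h := Submodule.mul_mem_mul hs ht
    rw [tensorGrading, tensorGrading, Submodule.span_mul_span] at h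
    refine Submodule.span_le.mpr ?_ h
    rintro _ ⟨_, ⟨p, q, rfl, x, hx, y, hy, rfl⟩, _, ⟨p', q', rfl, x', hx', y', hy', rfl⟩, rfl⟩
    have hxy := tmul_mem_tensorGrading (SetLike.GradedMul.mul_mem hx hx')
      (SetLike.GradedMul.mul_mem hy hy')
    simp only [tmul_mul_tmul_of_mem x y' hy hx', SetLike.mem_coe, Units.smul_def]
    rw [add_add_add_comm]
    exact Submodule.smul_of_tower_mem _ _ hxy

theorem includeLeft_mem_tensorGrading {p : ℕ} {x : A} (hx : x ∈ 𝒜 p) :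
    GradedTensorProduct.includeLeft 𝒜 ℬ x ∈ tensorGrading 𝒜 ℬ p :=
  tmul_mem_tensorGrading (q := 0) hx SetLike.GradedOne.one_mem

theorem includeRight_mem_tensorGrading {q : ℕ} {y : B} (hy : y ∈ ℬ q) :
    GradedTensorProduct.includeRight 𝒜 ℬ y ∈ tensorGrading 𝒜 ℬ q :=
  zero_add q ▸ tmul_mem_tensorGrading SetLike.GradedOne.one_mem hy

theorem lift_mem_of_mem_tensorGrading {C : Type*} [Ring C] [Algebra R C] {𝒞 : ℕ → Submodule R C}
    [SetLike.GradedMonoid 𝒞] {φ : A →ₐ[R] C} {ψ : B →ₐ[R] C} {h}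
    (hφ : ∀ p, ∀ x ∈ 𝒜 p, φ x ∈ 𝒞 p) (hψ : ∀ q, ∀ y ∈ ℬ q, ψ y ∈ 𝒞 q) {n : ℕ} {t : 𝒜 ᵍ⊗[R] ℬ}
    (ht : t ∈ tensorGrading 𝒜 ℬ n) : GradedTensorProduct.lift 𝒜 ℬ φ ψ h t ∈ 𝒞 n := by
  refine Submodule.span_induction ?_ (by simp) (fun _ _ _ _ hx hy => by
    rw [map_add]; exact add_mem hx hy) (fun r _ _ hx => by
    rw [map_smul]; exact Submodule.smul_mem _ r hx) ht
  rintro _ ⟨p, q, rfl, x, hx, y, hy, rfl⟩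
  rw [GradedTensorProduct.lift_tmul]
  exact SetLike.GradedMul.mul_mem (hφ p x hx) (hψ q y hy)

theorem includeRight_mul_includeLeft {p q : ℕ} {x : A} {y : B} (hx : x ∈ 𝒜 p) (hy : y ∈ ℬ q) :
    GradedTensorProduct.includeRight 𝒜 ℬ y * GradedTensorProduct.includeLeft 𝒜 ℬ x =
      (-1 : ℤˣ) ^ (q * p) •
        (GradedTensorProduct.includeLeft 𝒜 ℬ x * GradedTensorProduct.includeRight 𝒜 ℬ y) := by
  have h := tmul_mul_tmul_of_mem 1 1 hy hx
  rwa [one_mul, mul_one, ← GradedTensorProduct.tmul_one_mul_one_tmul 𝒜 ℬ x y] at h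

theorem OrlikSolomon.IsExterior.includeLeft_add_includeRight {X : Type*} {g₀ : X → A}
    {g₁ : X → B} (hg₀ : IsExterior R g₀) (hg₁ : IsExterior R g₁) (mem₀ : ∀ i, g₀ i ∈ 𝒜 1)
    (mem₁ : ∀ i, g₁ i ∈ ℬ 1) :
    IsExterior R fun i => GradedTensorProduct.includeLeft 𝒜 ℬ (g₀ i) +
      GradedTensorProduct.includeRight 𝒜 ℬ (g₁ i) := fun m => by
  have expand : Finsupp.linearCombination R (fun i => GradedTensorProduct.includeLeft 𝒜 ℬ (g₀ i) +
      GradedTensorProduct.includeRight 𝒜 ℬ (g₁ i)) m =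
      GradedTensorProduct.includeLeft 𝒜 ℬ (Finsupp.linearCombination R g₀ m) +
        GradedTensorProduct.includeRight 𝒜 ℬ (Finsupp.linearCombination R g₁ m) := by
    simp [Finsupp.linearCombination_apply, Finsupp.sum, Finset.sum_add_distrib]
  have left_mem : Finsupp.linearCombination R g₀ m ∈ 𝒜 1 :=
    Submodule.sum_smul_mem (𝒜 1) m fun i _ => mem₀ i
  have right_mem : Finsupp.linearCombination R g₁ m ∈ ℬ 1 :=
    Submodule.sum_smul_mem (ℬ 1) m fun i _ => mem₁ i
  rw [expand, add_mul, mul_add, mul_add, includeRight_mul_includeLeft left_mem right_mem,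
    ← map_mul (GradedTensorProduct.includeLeft 𝒜 ℬ),
    ← map_mul (GradedTensorProduct.includeRight 𝒜 ℬ), hg₀, hg₁, map_zero, map_zero, zero_add,
    add_zero, mul_one, pow_one, Units.neg_smul, one_smul, add_neg_cancel]

end GradedTensorProduct

namespace PointedMatroid

open OrlikSolomon
open scoped Matroid

variable {R : Type*} [CommRing R] {α β γ : Type*} {G : PointedMatroid α} {G₀ : PointedMatroid α}
  {G₁ : PointedMatroid β} {P : PointedMatroid γ} {f : G.Pt → P.Pt} {f₀ : G₀.Pt → P.Pt}
  {f₁ : G₁.Pt → P.Pt} {A : Type*} [Ring A] [Algebra R A]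

theorem gen_mem (i : G.Pt) : G.gen R i ∈ G.affineGrading R 1 :=
  Submodule.sub_mem _ (mk_mem_grading (e_mem i)) (mk_mem_grading (e_mem _))

theorem gen_basePt : G.gen R G.basePt = 0 := Subtype.ext (sub_self _)

theorem isOSFamily_gen : IsOSFamily R G.matroid (G.gen R) :=
  .of_map (φ := (G.affineOS R).val) Subtype.val_injective (isOSFamily_a.sub_const G.basePt)

theorem affineOS_algHom_ext {φ ψ : G.affineOS R →ₐ[R] A}
    (h : ∀ i, φ (G.gen R i) = ψ (G.gen R i)) : φ = ψ :=
  AlgHom.adjoin_ext <| by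
    rintro _ ⟨i, rfl⟩
    exact h i

theorem mul_comm_of_mem_affineGrading {p q : ℕ} {x y : G.affineOS R}
    (hx : x ∈ G.affineGrading R p) (hy : y ∈ G.affineGrading R q) :
    x * y = (-1 : ℤˣ) ^ (q * p) • (y * x) :=
  Subtype.ext (mul_comm_of_mem_grading hx hy)

/-- The homomorphism from the affine Orlik-Solomon algebra that sends `a i - a 0` to
`g i - g 0`. -/
def affineLift {g : G.Pt → A} (hg : IsOSFamily R G.matroid g) : G.affineOS R →ₐ[R] A :=
  hg.lift.comp (G.affineOS R).val

theorem affineLift_gen {g : G.Pt → A} (hg : IsOSFamily R G.matroid g) (hbase : g G.basePt = 0)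
    (i : G.Pt) : affineLift hg (G.gen R i) = g i := by
  change hg.lift (a R G.matroid i - a R G.matroid G.basePt) = g i
  rw [map_sub, hg.lift_a, hg.lift_a, hbase, sub_zero]

theorem affineLift_mem {g : G.Pt → A} (hg : IsOSFamily R G.matroid g) {𝒞 : ℕ → Submodule R A}
    [SetLike.GradedMonoid 𝒞] (h : ∀ i, g i ∈ 𝒞 1) {p : ℕ} {x : G.affineOS R}
    (hx : x ∈ G.affineGrading R p) : affineLift hg x ∈ 𝒞 p :=
  hg.lift_mem h hx

theorem isDependent_iff_not_pts_indep {S : List G.Pt} :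
    IsDependent G.matroid S ↔ ¬ G.pts.Indep {i | i ∈ S} := by
  rw [pts_indep_iff, isDependent_iff_not_indep]

namespace IsEmbedding

theorem isDependent_map_iff (hf : G.IsEmbedding P f) {S : List G.Pt} :
    IsDependent P.matroid (S.map f) ↔ IsDependent G.matroid S := by
  have h : {k | k ∈ S.map f} = f '' {i | i ∈ S} := Set.ext fun _ => List.mem_map
  rw [isDependent_iff_not_pts_indep, isDependent_iff_not_pts_indep, h, hf.pts_indep_image_iff]

theorem isOSFamily_comp (hf : G.IsEmbedding P f) {g : P.Pt → A} (hg : IsOSFamily R P.matroid g) :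
    IsOSFamily R G.matroid (g ∘ f) :=
  hg.comp fun _ => hf.isDependent_map_iff.mpr

/-- The homomorphism of affine Orlik-Solomon algebras induced by an embedding. -/
def affineMap (hf : G.IsEmbedding P f) : G.affineOS R →ₐ[R] P.affineOS R :=
  affineLift (hf.isOSFamily_comp isOSFamily_gen)

theorem affineMap_gen (hf : G.IsEmbedding P f) (i : G.Pt) :
    hf.affineMap (G.gen R i) = P.gen R (f i) :=
  affineLift_gen _ (by rw [Function.comp_apply, hf.map_base, gen_basePt]) i

theorem affineMap_mem (hf : G.IsEmbedding P f) {p : ℕ} {x : G.affineOS R}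
    (hx : x ∈ G.affineGrading R p) : hf.affineMap x ∈ P.affineGrading R p :=
  affineLift_mem (hf.isOSFamily_comp isOSFamily_gen) (𝒞 := P.affineGrading R)
    (fun i => gen_mem (f i)) hx

theorem lift_boundary_eProd_eq_zero (hf : G.IsEmbedding P f) {g : P.Pt → A} (hg : IsExterior R g)
    (hgf : IsOSFamily R G.matroid (g ∘ f)) {S : List P.Pt} (hSf : ∀ k ∈ S, k ∈ Set.range f)
    (hS : IsDependent P.matroid S) : hg.lift (boundary R P.Pt (eProd R S)) = 0 := by
  obtain ⟨S, rfl⟩ : S ∈ Set.range (List.map f) := by rwa [Set.range_list_map]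
  rw [hg.lift_boundary_eProd_map, hgf.lift_boundary S (hf.isDependent_map_iff.mp hS)]

end IsEmbedding

theorem IsUnion.mem_range_right (h : G₀.IsUnion G₁ P f₀ f₁) {k : P.Pt} (hk : k ∉ Set.range f₀) :
    k ∈ Set.range f₁ :=
  (h.union_eq.superset (Set.mem_univ k)).resolve_left hk

theorem IsEmbedding.basePt_mem_range (hf : G.IsEmbedding P f) : P.basePt ∈ Set.range f :=
  ⟨G.basePt, hf.map_base⟩

open Classical in
theorem IsFreeUnion.isDependent_filter (h : G₀.IsFreeUnion G₁ P f₀ f₁) {S : List P.Pt}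
    (hS : IsDependent P.matroid S) :
    IsDependent P.matroid (S.filter (· ∈ Set.range f₀)) ∨
      IsDependent P.matroid (S.filter (· ∈ Set.range f₁)) ∨
      IsDependent P.matroid (P.basePt :: S.filter (· ∈ Set.range f₀)) ∧
        IsDependent P.matroid (P.basePt :: S.filter (· ∉ Set.range f₀)) := by
  have setOf_mem_filter (s : Set P.Pt) : {k | k ∈ S.filter (· ∈ s)} = {k | k ∈ S} ∩ s := by
    ext k; simp
  have setOf_mem_filter_not :
      {k | k ∈ S.filter (· ∉ Set.range f₀)} = {k | k ∈ S} \ Set.range f₀ := by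
    ext k; simp
  have setOf_mem_cons (k : P.Pt) (T : List P.Pt) : {i | i ∈ k :: T} = insert k {i | i ∈ T} := by
    ext i; simp
  have insert_sdiff : insert P.basePt ({k | k ∈ S} \ Set.range f₀) =
      insert P.basePt ({k | k ∈ S} ∩ Set.range f₁) :=
    insert_sdiff_eq_insert_inter h.inter_eq (h.union_eq ▸ Set.subset_univ _)
  simp only [isDependent_iff_not_pts_indep, setOf_mem_cons, setOf_mem_filter_not, setOf_mem_filter,
    insert_sdiff] at hS ⊢
  by_contra hindep
  simp only [not_or, not_and_or, not_not] at hindep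
  obtain ⟨left, right, insert_or⟩ := hindep
  have restrict_indep {s J : Set P.Pt} (hJ : P.pts.Indep J) (hs : J ⊆ s) : (P.pts ↾ s).Indep J :=
    Matroid.restrict_indep_iff.mpr ⟨hJ, hs⟩
  exact hS <| h.indep_of_parallelIndep _
    { subset_ground := h.union_eq.superset.trans' (Set.subset_univ _)
      left := restrict_indep left Set.inter_subset_right
      right := restrict_indep right Set.inter_subset_right
      insert_or := insert_or.imp
        (restrict_indep · (Set.insert_subset h.left.basePt_mem_range Set.inter_subset_right))
        (restrict_indep · (Set.insert_subset h.right.basePt_mem_range Set.inter_subset_right)) }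

theorem IsFreeUnion.isOSFamily (h : G₀.IsFreeUnion G₁ P f₀ f₁) {g : P.Pt → A}
    (hg : IsExterior R g) (hbase : g P.basePt = 0) (hg₀ : IsOSFamily R G₀.matroid (g ∘ f₀))
    (hg₁ : IsOSFamily R G₁.matroid (g ∘ f₁)) : IsOSFamily R P.matroid g where
  isExterior := hg
  lift_boundary S hS := by
    classical
    have lift_basePt : hg.lift (e R P.basePt) = 0 := (hg.lift_e _).trans hbase
    have of_mem_filter {p : P.Pt → Prop} [DecidablePred p] : ∀ k ∈ S.filter p, p k := fun _ hk =>
      of_decide_eq_true (List.mem_filter.mp hk).2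
    rcases h.isDependent_filter hS with hdep | hdep | ⟨hdep₀, hdep₁⟩
    · have vanish := h.left.lift_boundary_eProd_eq_zero hg hg₀ of_mem_filter hdep
      exact map_boundary_eProd_eq_zero_of_filter _ (map_eProd_eq_zero hdep.ne_nil vanish)
        (by rw [vanish, zero_mul])
    · have vanish := h.right.lift_boundary_eProd_eq_zero hg hg₁ of_mem_filter hdep
      exact map_boundary_eProd_eq_zero_of_filter _ (map_eProd_eq_zero hdep.ne_nil vanish)
        (by rw [vanish, zero_mul])
    · have vanish₀ := map_eProd_eq_zero_of_cons lift_basePt <|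
        h.left.lift_boundary_eProd_eq_zero hg hg₀
          (List.forall_mem_cons.mpr ⟨h.left.basePt_mem_range, of_mem_filter⟩) hdep₀
      have vanish₁ := map_eProd_eq_zero_of_cons lift_basePt <|
        h.right.lift_boundary_eProd_eq_zero hg hg₁
          (List.forall_mem_cons.mpr ⟨h.right.basePt_mem_range, fun k hk =>
            h.mem_range_right (of_mem_filter k hk)⟩) hdep₁
      exact map_boundary_eProd_eq_zero_of_filter _ vanish₀ (by rw [vanish₁, mul_zero])

/-- The left inverse of an embedding `f` that sends all points outside its range to the base
point. -/
def collapse (f : G.Pt → P.Pt) : P.Pt → G.Pt := Function.extend f id fun _ => G.basePt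

theorem IsEmbedding.collapse_apply (hf : G.IsEmbedding P f) (i : G.Pt) : collapse f (f i) = i :=
  hf.injective.extend_apply id _ i

theorem collapse_of_notMem_range {k : P.Pt} (hk : k ∉ Set.range f) : collapse f k = G.basePt :=
  Function.extend_apply' id _ k hk

theorem IsEmbedding.collapse_basePt (hf : G.IsEmbedding P f) :
    collapse f P.basePt = G.basePt := by
  rw [← hf.map_base, hf.collapse_apply]

theorem IsUnion.collapse_left_right (h : G₀.IsUnion G₁ P f₀ f₁) (j : G₁.Pt) :
    collapse f₀ (f₁ j) = G₀.basePt := by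
  by_cases hj : f₁ j ∈ Set.range f₀
  · rw [show f₁ j = P.basePt from h.inter_eq.subset ⟨hj, j, rfl⟩, h.left.collapse_basePt]
  · exact collapse_of_notMem_range hj

theorem IsUnion.collapse_right_left (h : G₀.IsUnion G₁ P f₀ f₁) (i : G₀.Pt) :
    collapse f₁ (f₀ i) = G₁.basePt :=
  h.symm.collapse_left_right i

variable (R) in
/-- The images of the generators under the inverse of the isomorphism: `(a i - a 0) ⊗ 1` at
`f₀ i`, and `1 ⊗ (a j - a 0)` at `f₁ j`. -/
def tensorGen (f₀ : G₀.Pt → P.Pt) (f₁ : G₁.Pt → P.Pt) (k : P.Pt) :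
    G₀.affineGrading R ᵍ⊗[R] G₁.affineGrading R :=
  GradedTensorProduct.includeLeft _ _ (G₀.gen R (collapse f₀ k)) +
    GradedTensorProduct.includeRight _ _ (G₁.gen R (collapse f₁ k))

theorem tensorGen_mem (k : P.Pt) : tensorGen R f₀ f₁ k ∈
    tensorGrading (G₀.affineGrading R) (G₁.affineGrading R) 1 :=
  Submodule.add_mem _ (includeLeft_mem_tensorGrading (gen_mem _))
    (includeRight_mem_tensorGrading (gen_mem _))

theorem isExterior_tensorGen : IsExterior R (tensorGen R f₀ f₁) :=
  (isOSFamily_gen.isExterior.comp (collapse f₀)).includeLeft_add_includeRight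
    (isOSFamily_gen.isExterior.comp (collapse f₁)) (fun _ => gen_mem _) (fun _ => gen_mem _)

namespace IsUnion

theorem tensorGen_left (h : G₀.IsUnion G₁ P f₀ f₁) (i : G₀.Pt) :
    tensorGen R f₀ f₁ (f₀ i) = GradedTensorProduct.includeLeft _ _ (G₀.gen R i) := by
  rw [tensorGen, h.left.collapse_apply, h.collapse_right_left, gen_basePt, map_zero, add_zero]

theorem tensorGen_right (h : G₀.IsUnion G₁ P f₀ f₁) (j : G₁.Pt) :
    tensorGen R f₀ f₁ (f₁ j) = GradedTensorProduct.includeRight _ _ (G₁.gen R j) := by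
  rw [tensorGen, h.right.collapse_apply, h.collapse_left_right, gen_basePt, map_zero, zero_add]

theorem tensorGen_basePt (h : G₀.IsUnion G₁ P f₀ f₁) : tensorGen R f₀ f₁ P.basePt = 0 := by
  rw [← h.left.map_base, h.tensorGen_left, gen_basePt, map_zero]

theorem isOSFamily_tensorGen_left (h : G₀.IsUnion G₁ P f₀ f₁) :
    IsOSFamily R G₀.matroid (tensorGen R f₀ f₁ ∘ f₀) :=
  (funext h.tensorGen_left : tensorGen R f₀ f₁ ∘ f₀ = _) ▸ isOSFamily_gen.map _

theorem isOSFamily_tensorGen_right (h : G₀.IsUnion G₁ P f₀ f₁) :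
    IsOSFamily R G₁.matroid (tensorGen R f₀ f₁ ∘ f₁) :=
  (funext h.tensorGen_right : tensorGen R f₀ f₁ ∘ f₁ = _) ▸ isOSFamily_gen.map _

variable (R) in
/-- The natural homomorphism to the affine Orlik-Solomon algebra of a union, induced by the two
inclusions. -/
def fromTensor (h : G₀.IsUnion G₁ P f₀ f₁) :
    (G₀.affineGrading R ᵍ⊗[R] G₁.affineGrading R) →ₐ[R] P.affineOS R :=
  GradedTensorProduct.lift _ _ h.left.affineMap h.right.affineMap fun _ _ x y =>
    mul_comm_of_mem_affineGrading (h.left.affineMap_mem x.2) (h.right.affineMap_mem y.2)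

theorem fromTensor_left (h : G₀.IsUnion G₁ P f₀ f₁) (i : G₀.Pt) :
    h.fromTensor R (G₀.gen R i ᵍ⊗ₜ[R] 1) = P.gen R (f₀ i) := by
  rw [fromTensor, GradedTensorProduct.lift_tmul, map_one, mul_one, h.left.affineMap_gen]

theorem fromTensor_right (h : G₀.IsUnion G₁ P f₀ f₁) (j : G₁.Pt) :
    h.fromTensor R (1 ᵍ⊗ₜ[R] G₁.gen R j) = P.gen R (f₁ j) := by
  rw [fromTensor, GradedTensorProduct.lift_tmul, map_one, one_mul, h.right.affineMap_gen]

theorem fromTensor_mem (h : G₀.IsUnion G₁ P f₀ f₁) {n : ℕ}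
    {t : G₀.affineGrading R ᵍ⊗[R] G₁.affineGrading R}
    (ht : t ∈ tensorGrading (G₀.affineGrading R) (G₁.affineGrading R) n) :
    h.fromTensor R t ∈ P.affineGrading R n :=
  lift_mem_of_mem_tensorGrading (𝒞 := P.affineGrading R) (fun _ _ => h.left.affineMap_mem)
    (fun _ _ => h.right.affineMap_mem) ht

theorem fromTensor_tensorGen (h : G₀.IsUnion G₁ P f₀ f₁) (k : P.Pt) :
    h.fromTensor R (tensorGen R f₀ f₁ k) = P.gen R k := by
  rcases h.union_eq.superset (Set.mem_univ k) with ⟨i, rfl⟩ | ⟨j, rfl⟩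
  · exact (congrArg _ (h.tensorGen_left i)).trans (h.fromTensor_left i)
  · exact (congrArg _ (h.tensorGen_right j)).trans (h.fromTensor_right j)

end IsUnion

namespace IsFreeUnion

theorem isOSFamily_tensorGen (h : G₀.IsFreeUnion G₁ P f₀ f₁) :
    IsOSFamily R P.matroid (tensorGen R f₀ f₁) :=
  h.isOSFamily isExterior_tensorGen h.tensorGen_basePt h.isOSFamily_tensorGen_left
    h.isOSFamily_tensorGen_right

variable (R) in
/-- The inverse of the natural homomorphism `fromTensor`. -/
def toTensor (h : G₀.IsFreeUnion G₁ P f₀ f₁) :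
    P.affineOS R →ₐ[R] (G₀.affineGrading R ᵍ⊗[R] G₁.affineGrading R) :=
  affineLift h.isOSFamily_tensorGen

theorem toTensor_gen (h : G₀.IsFreeUnion G₁ P f₀ f₁) (k : P.Pt) :
    h.toTensor R (P.gen R k) = tensorGen R f₀ f₁ k :=
  affineLift_gen h.isOSFamily_tensorGen h.tensorGen_basePt k

theorem toTensor_mem (h : G₀.IsFreeUnion G₁ P f₀ f₁) {n : ℕ} {x : P.affineOS R}
    (hx : x ∈ P.affineGrading R n) :
    h.toTensor R x ∈ tensorGrading (G₀.affineGrading R) (G₁.affineGrading R) n :=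
  affineLift_mem h.isOSFamily_tensorGen tensorGen_mem hx

theorem fromTensor_comp_toTensor (h : G₀.IsFreeUnion G₁ P f₀ f₁) :
    (h.fromTensor R).comp (h.toTensor R) = .id R (P.affineOS R) :=
  affineOS_algHom_ext fun k => by
    rw [AlgHom.comp_apply, toTensor_gen, h.fromTensor_tensorGen, AlgHom.id_apply]

theorem toTensor_comp_fromTensor (h : G₀.IsFreeUnion G₁ P f₀ f₁) :
    (h.toTensor R).comp (h.fromTensor R) =
      .id R (G₀.affineGrading R ᵍ⊗[R] G₁.affineGrading R) := by
  have on_tensorGen (k : P.Pt) :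
      h.toTensor R (h.fromTensor R (tensorGen R f₀ f₁ k)) = tensorGen R f₀ f₁ k := by
    rw [h.fromTensor_tensorGen, toTensor_gen]
  exact GradedTensorProduct.algHom_ext _ _
    (affineOS_algHom_ext fun i => by
      have h₀ := on_tensorGen (f₀ i)
      rw [h.tensorGen_left] at h₀
      exact h₀)
    (affineOS_algHom_ext fun j => by
      have h₁ := on_tensorGen (f₁ j)
      rw [h.tensorGen_right] at h₁
      exact h₁)

variable (R) in
/-- The natural isomorphism from the tensor product of two affine Orlik-Solomon algebras to the
affine Orlik-Solomon algebra of a free union. -/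
def tensorEquiv (h : G₀.IsFreeUnion G₁ P f₀ f₁) :
    (G₀.affineGrading R ᵍ⊗[R] G₁.affineGrading R) ≃ₐ[R] P.affineOS R :=
  .ofAlgHom (h.fromTensor R) (h.toTensor R) h.fromTensor_comp_toTensor h.toTensor_comp_fromTensor

theorem map_tensorGrading (h : G₀.IsFreeUnion G₁ P f₀ f₁) (n : ℕ) :
    (tensorGrading (G₀.affineGrading R) (G₁.affineGrading R) n).map
      (h.tensorEquiv R).toLinearMap = P.affineGrading R n :=
  le_antisymm (Submodule.map_le_iff_le_comap.mpr fun _ ht => h.fromTensor_mem ht) fun x hx =>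
    ⟨h.toTensor R x, h.toTensor_mem hx, DFunLike.congr_fun h.fromTensor_comp_toTensor x⟩

end IsFreeUnion

end PointedMatroid

end

theorem theorem3p8_general {R : Type*} [CommRing R] {α β γ : Type*}
    (G₀ : PointedMatroid α) (G₁ : PointedMatroid β) [G₀.matroid.RankFinite]
    [G₁.matroid.RankFinite] (P : PointedMatroid γ) (f₀ : G₀.Pt → P.Pt) (f₁ : G₁.Pt → P.Pt)
    (hP : G₀.IsParallelConnection G₁ P f₀ f₁) :
    ∃ Φ : (G₀.affineGrading R ᵍ⊗[R] G₁.affineGrading R) ≃ₐ[R] P.affineOS R,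
      (∀ n : ℕ, (tensorGrading (G₀.affineGrading R) (G₁.affineGrading R) n).map Φ.toLinearMap
        = P.affineGrading R n) ∧
      (∀ i : G₀.Pt, Φ (G₀.gen R i ᵍ⊗ₜ[R] 1) = P.gen R (f₀ i)) ∧
      (∀ j : G₁.Pt, Φ (1 ᵍ⊗ₜ[R] G₁.gen R j) = P.gen R (f₁ j)) :=
  have hP := hP.isFreeUnion
  ⟨hP.tensorEquiv R, hP.map_tensorGrading, hP.fromTensor_left, hP.fromTensor_right⟩

theorem theorem3p8 {R : Type*} [CommRing R] {α β γ : Type*}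
    (G₀ : PointedMatroid α) (G₁ : PointedMatroid β) [G₀.matroid.Finite] [G₁.matroid.Finite]
    (h₀ : G₀.matroid.IsNonloop G₀.base) (h₁ : G₁.matroid.IsNonloop G₁.base)
    (P : PointedMatroid γ) (f₀ : G₀.Pt → P.Pt) (f₁ : G₁.Pt → P.Pt)
    (hP : G₀.IsParallelConnection G₁ P f₀ f₁) :
    ∃ Φ : (G₀.affineGrading R ᵍ⊗[R] G₁.affineGrading R) ≃ₐ[R] P.affineOS R,
      (∀ n : ℕ, (tensorGrading (G₀.affineGrading R) (G₁.affineGrading R) n).map Φ.toLinearMap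
        = P.affineGrading R n) ∧
      (∀ i : G₀.Pt, Φ (G₀.gen R i ᵍ⊗ₜ[R] 1) = P.gen R (f₀ i)) ∧
      (∀ j : G₁.Pt, Φ (1 ᵍ⊗ₜ[R] G₁.gen R j) = P.gen R (f₁ j)) :=
  theorem3p8_general G₀ G₁ P f₀ f₁ hP
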